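/- Let $n\ge 4$ be an integer, let $A_n$ be the alternating group on $\{1,\dots,n\}$, and let $$S=\begin{cases}\{(1,2,3),\ (1,3,2),\ (2,3,\ldots,n),\ (2,n,\ldots,3)\}, & n \text{ even},\\ \{(1,2,3),\ (1,3,2),\ (1,2,\ldots,n),\ (1,n,\ldots,2)\}, & n\text{ odd}.\end{cases}$$ Let $G=C(A_n,S)$ be the Cayley graph with vertex set $A_n$ in which distinct $g,h$ are adjacent if and only if $h=gs$ for some $s\in S$. The total chromatic number $\chi''(G)$ is the least $k$ for which the vertices and edges of $G$ can be colored with $k$ colors such that no two adjacent vertices, no two distinct edges with a common end, and no vertex and edge incident to it receive the same color. Then $G$ is of type I, that is, $\chi''(G)=\Delta(G)+1$, where $\Delta(G)$ is the maximum degree of $G$; explicitly, $\chi''(G)=5$. -/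

import Mathlib

namespace SimpleGraph

/-- A total coloring of `G`: a map from the vertices and edges of `G` to a set `α` of colors giving
different colors to adjacent vertices, to distinct edges with a common end, and to a vertex and an
edge incident to it. -/
structure IsTotalColoring {V α : Type*} (G : SimpleGraph V) (c : V ⊕ G.edgeSet → α) : Prop where
  vertex_vertex : ∀ u v : V, G.Adj u v → c (Sum.inl u) ≠ c (Sum.inl v)
  edge_edge : ∀ e f : G.edgeSet, e ≠ f → (∃ v : V, v ∈ (e : Sym2 V) ∧ v ∈ (f : Sym2 V)) →
    c (Sum.inr e) ≠ c (Sum.inr f)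
  vertex_edge : ∀ (v : V) (e : G.edgeSet), v ∈ (e : Sym2 V) → c (Sum.inl v) ≠ c (Sum.inr e)

/-- `G` has a total coloring with (at most) `k` colors. -/
def TotalColorable {V : Type*} (G : SimpleGraph V) (k : ℕ) : Prop :=
  ∃ c : V ⊕ G.edgeSet → Fin k, G.IsTotalColoring c

/-- The total chromatic number: the least number of colors of a total coloring of `G`
(`⊤` if no finite number of colors suffices). -/
noncomputable def totalChromaticNumber {V : Type*} (G : SimpleGraph V) : ℕ∞ :=
  ⨅ k ∈ {k : ℕ | G.TotalColorable k}, (k : ℕ∞)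

open Classical in
/-- A finite graph is of type I if its total chromatic number is its maximum degree plus one. -/
def IsTypeI {V : Type*} [Fintype V] (G : SimpleGraph V) : Prop :=
  G.totalChromaticNumber = (G.maxDegree : ℕ∞) + 1

end SimpleGraph

namespace AlternatingCayley

open Equiv

/-- The cycle `(1, 2, 3)`; the points `1, …, n` are the elements `0, …, n - 1` of `Fin n`, in this
order. -/
def threeCycle (n : ℕ) : Perm (Fin n) := ((List.finRange n).take 3).formPerm

/-- The cycle `(2, 3, …, n)` if `n` is even, and the cycle `(1, 2, …, n)` if `n` is odd. -/
def longCycle (n : ℕ) : Perm (Fin n) :=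
  if Even n then (List.finRange n).tail.formPerm else (List.finRange n).formPerm

/-- The set `S`, consisting of `(1, 2, 3)`, the long cycle and their inverses. -/
def permSet (n : ℕ) : Set (Perm (Fin n)) :=
  {threeCycle n, (threeCycle n)⁻¹, longCycle n, (longCycle n)⁻¹}

/-- A cycle of odd length is an even permutation. -/
theorem formPerm_mem_alternatingGroup {n : ℕ} {l : List (Fin n)} (hl : l.Nodup)
    (hodd : Odd l.length) : l.formPerm ∈ alternatingGroup (Fin n) := by
  rw [Perm.mem_alternatingGroup]
  rcases Nat.lt_or_ge l.length 2 with h | h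
  · rw [(List.formPerm_eq_one_iff l hl).2 (by omega)]
    simp
  · rw [(List.isCycle_formPerm hl h).sign,
      List.support_formPerm_of_nodup l hl (by rintro x rfl; simp at h),
      List.toFinset_card_of_nodup hl, hodd.neg_one_pow, neg_neg]

theorem threeCycle_mem {n : ℕ} (hn : 3 ≤ n) : threeCycle n ∈ alternatingGroup (Fin n) := by
  apply formPerm_mem_alternatingGroup
  · exact (List.nodup_finRange n).sublist (List.take_sublist _ _)
  · rw [List.length_take, List.length_finRange, min_eq_left hn]
    decide

theorem longCycle_mem {n : ℕ} (hn : 1 ≤ n) : longCycle n ∈ alternatingGroup (Fin n) := by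
  unfold longCycle
  split_ifs with h
  · apply formPerm_mem_alternatingGroup
    · exact (List.nodup_finRange n).sublist (List.tail_sublist _)
    · rw [List.length_tail, List.length_finRange]
      exact Nat.Even.sub_odd hn h odd_one
  · apply formPerm_mem_alternatingGroup (List.nodup_finRange n)
    rw [List.length_finRange]
    exact Nat.not_even_iff_odd.1 h

/-- All elements of `S` are even permutations, so `S` is a subset of `A_n`. -/
theorem permSet_subset {n : ℕ} (hn : 3 ≤ n) :
    permSet n ⊆ (alternatingGroup (Fin n) : Set (Perm (Fin n))) := by
  have h1 := threeCycle_mem hn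
  have h2 := longCycle_mem (by omega : 1 ≤ n)
  rintro g (rfl | rfl | rfl | rfl)
  · exact h1
  · exact inv_mem h1
  · exact h2
  · exact inv_mem h2

/-- The set `S` as a subset of `A_n`. -/
def generators (n : ℕ) : Set (alternatingGroup (Fin n)) :=
  {g | (g : Perm (Fin n)) ∈ permSet n}

/-- The Cayley graph `C(A_n, S)`. -/
def graph (n : ℕ) : SimpleGraph (alternatingGroup (Fin n)) :=
  SimpleGraph.mulCayley (generators n)

end AlternatingCayley

/-! ### Total colorings of Cayley graphs on two generators, degrees and the lower bound -/

namespace SimpleGraph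

/-! A vertex and its four edges need five colors, so the work is to find a total coloring with five.
Read `g` as the word `g 0, …, g (n - 1)`. Right multiplication by the 3-cycle rotates the first
three letters; the long cycle rotates the whole word (`n` odd) or all but its first letter (`n`
even). If the vertices of a 3-cycle triangle get three labels, repeated on the opposite edges, the
other two colors remain for the long-cycle edges (`totalColorable_graph`).

Long-cycle edges are colored by the place `p` of the largest letter `n - 1`. For `p ≥ 3` they use
two colors below 3; the leftover one, with 3 and 4, labels the triangle. The label records the rank
of the middle letter (`n` odd) or of the first letter (`n` even) among the first three, so rotation
yields three different labels. A step along the long cycle cannot repeat 3 or 4, since one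
comparison would have to hold both ways, and it does not repeat the leftover color if that changes.
At the few places where it does not change, the `After` labels repair the clash.

Places `p ≤ 2` have labels of their own. For even `n` and `p = 0` the long cycle fixes `n - 1`, so
the place of `n - 2` is used, and two kinds of vertices are recolored. The case `n = 4` is a finite
table. The main lemmas are `oddColor_shift` and `evenColor_shift`. -/

theorem TotalColorable.degree_lt {V : Type*} {G : SimpleGraph V} {k : ℕ} (h : G.TotalColorable k)
    (v : V) [Fintype (G.neighborSet v)] : G.degree v < k := by
  obtain ⟨c, hc⟩ := h
  let f : Option (G.neighborSet v) → Fin k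
    | none => c (Sum.inl v)
    | some w => c (Sum.inr ⟨s(v, w), w.2⟩)
  have hf : Function.Injective f := by
    rintro (_ | w) (_ | w') h
    · rfl
    · exact absurd h (hc.vertex_edge v _ (Sym2.mem_mk_left _ _))
    · exact absurd h.symm (hc.vertex_edge v _ (Sym2.mem_mk_left _ _))
    · by_contra hne
      refine hc.edge_edge _ _ ?_ ⟨v, Sym2.mem_mk_left _ _, Sym2.mem_mk_left _ _⟩ h
      intro he
      apply hne
      have := Sym2.congr_right.1 (congrArg Subtype.val he)
      rw [Subtype.ext this]
  have := Fintype.card_le_of_injective f hf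
  rw [Fintype.card_option, card_neighborSet_eq_degree, Fintype.card_fin] at this
  exact this

/-- A total coloring of a Cayley graph given by the colors `cV g` of the vertices, `cA g` of the
edges from `g` to `g * a` and `cB g` of the edges from `g` to `g * b`. -/
theorem totalColorable_mulCayley {Γ : Type*} [Group Γ] {S : Set Γ} {a b : Γ}
    (hS : ∀ s ∈ S, s = a ∨ s = a⁻¹ ∨ s = b ∨ s = b⁻¹) {k : ℕ} (cV cA cB : Γ → Fin k)
    (h : ∀ g, [cV g, cA g, cA (g * a⁻¹), cB g, cB (g * b⁻¹)].Nodup)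
    (ha : ∀ g, cV g ≠ cV (g * a)) (hb : ∀ g, cV g ≠ cV (g * b)) :
    (mulCayley S).TotalColorable k := by
  have key : ∀ u v, (mulCayley S).Adj u v → v = u * a ∨ u = v * a ∨ v = u * b ∨ u = v * b := by
    intro u v huv
    obtain ⟨-, s, hs, h | h⟩ := (mulCayley_adj' S u v).1 huv <;>
    · subst h
      rcases hS s hs with rfl | rfl | rfl | rfl <;> simp
  have ex : ∀ e : (mulCayley S).edgeSet, ∃ g, ∃ i : Bool,
      (e : Sym2 Γ) = s(g, g * cond i a b) := by
    rintro ⟨e, he⟩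
    induction e with | _ u v
    rcases key u v he with h | h | h | h
    · exact ⟨u, true, by simp [h]⟩
    · exact ⟨v, true, by simp [h, Sym2.eq_swap]⟩
    · exact ⟨u, false, by simp [h]⟩
    · exact ⟨v, false, by simp [h, Sym2.eq_swap]⟩
  choose r i hri using ex
  let col : (mulCayley S).edgeSet → Fin k := fun e => cond (i e) (cA (r e)) (cB (r e))
  -- Whichever representation of an edge was chosen, at `v` it occupies one of four positions, and
  -- two edges in the same position are equal.
  have port : ∀ (e : (mulCayley S).edgeSet) (v : Γ), v ∈ (e : Sym2 Γ) →
      ((e : Sym2 Γ) = s(v, v * a) ∧ col e = cA v) ∨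
      ((e : Sym2 Γ) = s(v * a⁻¹, v) ∧ col e = cA (v * a⁻¹)) ∨
      ((e : Sym2 Γ) = s(v, v * b) ∧ col e = cB v) ∨
      ((e : Sym2 Γ) = s(v * b⁻¹, v) ∧ col e = cB (v * b⁻¹)) := by
    intro e v hv
    have he := hri e
    rw [he, Sym2.mem_iff] at hv
    rw [he]
    cases hi : i e <;> simp only [hi, cond_true, cond_false, col] at hv ⊢ <;>
      rcases hv with rfl | rfl <;> simp
  refine ⟨Sum.elim cV col, ?_, ?_, ?_⟩
  · intro u v huv
    simp only [Sum.elim_inl]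
    rcases key u v huv with rfl | rfl | rfl | rfl
    · exact ha u
    · exact (ha v).symm
    · exact hb u
    · exact (hb v).symm
  · rintro e f hef ⟨v, hve, hvf⟩
    simp only [Sum.elim_inr]
    have hne : (e : Sym2 Γ) ≠ f := fun h => hef (Subtype.ext h)
    have hv := h v
    simp only [List.nodup_cons, List.mem_cons, List.not_mem_nil, or_false, not_or,
      not_false_eq_true, List.nodup_nil, and_true] at hv
    obtain ⟨-, ⟨h1, h2, h3⟩, ⟨h4, h5⟩, h6⟩ := hv
    rcases port e v hve with ⟨he, ce⟩ | ⟨he, ce⟩ | ⟨he, ce⟩ | ⟨he, ce⟩ <;>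
      rcases port f v hvf with ⟨hf, cf⟩ | ⟨hf, cf⟩ | ⟨hf, cf⟩ | ⟨hf, cf⟩ <;>
      rw [ce, cf] <;>
      first
      | exact absurd (he.trans hf.symm) hne
      | assumption
      | exact Ne.symm ‹_›
  · intro v e hve
    simp only [Sum.elim_inl, Sum.elim_inr]
    have hv := h v
    simp only [List.nodup_cons, List.mem_cons, List.not_mem_nil, or_false, not_or] at hv
    obtain ⟨⟨h1, h2, h3, h4⟩, -⟩ := hv
    rcases port e v hve with ⟨-, ce⟩ | ⟨-, ce⟩ | ⟨-, ce⟩ | ⟨-, ce⟩ <;> rw [ce] <;> assumption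

theorem degree_mulCayley {Γ : Type*} [Group Γ] {S : Set Γ} {a b : Γ}
    (hS : ∀ s, s ∈ S ↔ s = a ∨ s = a⁻¹ ∨ s = b ∨ s = b⁻¹) (h : [1, a, a⁻¹, b, b⁻¹].Nodup) (g : Γ)
    [Fintype ((mulCayley S).neighborSet g)] : (mulCayley S).degree g = 4 := by
  classical
  simp only [List.nodup_cons, List.mem_cons, List.not_mem_nil, or_false, not_or,
    not_false_eq_true, List.nodup_nil, and_true] at h
  obtain ⟨⟨h1, h2, h3, h4⟩, ⟨h5, h6, h7⟩, ⟨h8, h9⟩, h10⟩ := h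
  have : (mulCayley S).neighborFinset g = {g * a, g * a⁻¹, g * b, g * b⁻¹} := by
    ext u
    rw [mem_neighborFinset, mulCayley_adj, hS, hS]
    simp only [Finset.mem_insert, Finset.mem_singleton]
    constructor
    · rintro ⟨-, (h | h | h | h) | (h | h | h | h)⟩ <;>
        rw [inv_mul_eq_iff_eq_mul] at h <;> simp [h]
    · rintro (rfl | rfl | rfl | rfl) <;> simp [Ne.symm h1, Ne.symm h2, Ne.symm h3, Ne.symm h4, *]
  rw [← card_neighborFinset_eq_degree, this]
  rw [Finset.card_insert_of_notMem, Finset.card_insert_of_notMem, Finset.card_insert_of_notMem,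
    Finset.card_singleton] <;> simp_all

theorem isTypeI_and_totalChromaticNumber_eq {V : Type*} [Fintype V] [Nonempty V]
    {G : SimpleGraph V} [DecidableRel G.Adj] {d : ℕ} (hd : ∀ v, G.degree v = d)
    (h : G.TotalColorable (d + 1)) :
    G.IsTypeI ∧ G.totalChromaticNumber = (d : ℕ∞) + 1 := by
  have hmax : G.maxDegree = d := by
    obtain ⟨v, hv⟩ := G.exists_maximal_degree_vertex
    rw [hv, hd]
  have hchi : G.totalChromaticNumber = (d : ℕ∞) + 1 := by
    apply le_antisymm
    · exact (iInf₂_le (d + 1) h).trans (by simp)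
    · refine le_iInf₂ fun k hk => ?_
      have := TotalColorable.degree_lt hk (Classical.arbitrary V)
      rw [hd] at this
      exact_mod_cast this
  refine ⟨?_, hchi⟩
  rw [IsTypeI, hchi, ← hmax]
  congr!

end SimpleGraph

namespace AlternatingCayley

open Equiv

/-! ### Permutations as words: letters and places -/

variable {n : ℕ}

/-- The `i`-th letter of the word `g 0, g 1, …, g (n - 1)`. -/
def letter (g : Perm (Fin n)) (i : ℕ) : ℕ := if h : i < n then (g ⟨i, h⟩ : ℕ) else i

/-- The place of the letter `k` in the word `g 0, g 1, …, g (n - 1)`. -/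
def place (g : Perm (Fin n)) (k : ℕ) : ℕ := letter g⁻¹ k

theorem letter_of_lt (g : Perm (Fin n)) {i : ℕ} (h : i < n) : letter g i = g ⟨i, h⟩ := dif_pos h

theorem letter_lt (g : Perm (Fin n)) {i : ℕ} (h : i < n) : letter g i < n := by
  rw [letter_of_lt g h]
  exact (g ⟨i, h⟩).2

theorem letter_mul (g c : Perm (Fin n)) (i : ℕ) : letter (g * c) i = letter g (letter c i) := by
  by_cases h : i < n
  · rw [letter_of_lt _ h, letter_of_lt c h, letter_of_lt g (c ⟨i, h⟩).2]
    rfl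
  · simp [letter, h]

theorem letter_one (i : ℕ) : letter (1 : Perm (Fin n)) i = i := by
  by_cases h : i < n <;> simp [letter, h]

theorem letter_inv_eq_iff (g : Perm (Fin n)) {i k : ℕ} : letter g⁻¹ k = i ↔ letter g i = k := by
  constructor
  · rintro rfl
    rw [← letter_mul, mul_inv_cancel, letter_one]
  · rintro rfl
    rw [← letter_mul, inv_mul_cancel, letter_one]

theorem place_eq_iff (g : Perm (Fin n)) {i k : ℕ} : place g k = i ↔ letter g i = k :=
  letter_inv_eq_iff g

theorem letter_ne (g : Perm (Fin n)) {i j : ℕ} (h : i ≠ j) : letter g i ≠ letter g j := by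
  intro e
  apply h
  rw [← (place_eq_iff g).2 e, (place_eq_iff g).2 rfl]

theorem place_lt (g : Perm (Fin n)) {k : ℕ} (h : k < n) : place g k < n := letter_lt _ h

theorem place_mul (g c : Perm (Fin n)) (k : ℕ) : place (g * c) k = place c (place g k) := by
  simp [place, letter_mul]

theorem letter_formPerm_getElem {l : List (Fin n)} (hl : l.Nodup) (i : ℕ) (h : i < l.length) :
    letter l.formPerm (l[i] : ℕ) = (l[(i + 1) % l.length]'(Nat.mod_lt _ (by omega)) : ℕ) := by
  rw [letter_of_lt _ (l[i]).2]
  exact congrArg Fin.val (List.formPerm_apply_getElem l hl i h)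

theorem letter_formPerm_of_notMem {l : List (Fin n)} {i : ℕ} (h : ∀ j ∈ l, (j : ℕ) ≠ i) :
    letter l.formPerm i = i := by
  by_cases hi : i < n
  · rw [letter_of_lt _ hi, List.formPerm_apply_of_notMem]
    exact fun hmem => h _ hmem rfl
  · simp [letter, hi]

theorem letter_threeCycle (hn : 3 ≤ n) (i : ℕ) :
    letter (threeCycle n) i = if i < 3 then (i + 1) % 3 else i := by
  have hl : ((List.finRange n).take 3).length = 3 := by simp [hn]
  have hnd : ((List.finRange n).take 3).Nodup :=
    (List.nodup_finRange n).sublist (List.take_sublist _ _)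
  split_ifs with h
  · have := letter_formPerm_getElem hnd i (by omega)
    simpa [hn, threeCycle] using this
  · apply letter_formPerm_of_notMem
    intro j hj
    obtain ⟨k, hk, rfl⟩ := List.getElem_of_mem hj
    simp at hk ⊢
    omega

theorem letter_longCycle_of_odd (hn : Odd n) {i : ℕ} (hi : i < n) :
    letter (longCycle n) i = (i + 1) % n := by
  rw [longCycle, if_neg (Nat.not_even_iff_odd.2 hn)]
  have := letter_formPerm_getElem (List.nodup_finRange n) i (by simpa using hi)
  simpa only [List.getElem_finRange, List.length_finRange, Fin.val_cast] using this

theorem letter_longCycle_of_even (hn : Even n) {i : ℕ} (h0 : 0 < i) (hi : i < n) :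
    letter (longCycle n) i = i % (n - 1) + 1 := by
  rw [longCycle, if_pos hn]
  have := letter_formPerm_getElem ((List.nodup_finRange n).sublist (List.tail_sublist _)) (i - 1)
    (by simp; omega)
  simpa [Nat.sub_add_cancel h0] using this

theorem letter_longCycle_zero_of_even (hn : Even n) : letter (longCycle n) 0 = 0 := by
  rw [longCycle, if_pos hn]
  apply letter_formPerm_of_notMem
  intro j hj
  obtain ⟨k, hk, rfl⟩ := List.getElem_of_mem hj
  simp

theorem place_threeCycle (hn : 3 ≤ n) (i : ℕ) :
    place (threeCycle n) i = if i < 3 then (i + 2) % 3 else i := by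
  rw [place_eq_iff, letter_threeCycle hn]
  split_ifs <;> omega

theorem place_longCycle_of_odd (hn : Odd n) {i : ℕ} (hi : i < n) :
    place (longCycle n) i = if i = 0 then n - 1 else i - 1 := by
  rw [place_eq_iff, letter_longCycle_of_odd hn (by split_ifs <;> omega)]
  split_ifs with h
  · rw [Nat.sub_add_cancel (by omega), Nat.mod_self, h]
  · rw [Nat.sub_add_cancel (by omega), Nat.mod_eq_of_lt hi]

theorem place_longCycle_of_even (hn : Even n) (h2 : 2 < n) {i : ℕ} (hi : i < n) :
    place (longCycle n) i = if i = 0 then 0 else if i = 1 then n - 1 else i - 1 := by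
  rw [place_eq_iff]
  split_ifs with h h'
  · rw [letter_longCycle_zero_of_even hn, h]
  · rw [letter_longCycle_of_even hn (by omega) (by omega), Nat.mod_self, h']
  · rw [letter_longCycle_of_even hn (by omega) (by omega), Nat.mod_eq_of_lt (by omega)]
    omega

theorem threeCycle_pow (hn : 3 ≤ n) : threeCycle n * threeCycle n * threeCycle n = 1 := by
  ext i
  have : letter (threeCycle n * threeCycle n * threeCycle n) i = i := by
    simp only [letter_mul, letter_threeCycle hn]
    split_ifs <;> omega
  rw [letter_of_lt _ i.2] at this
  simpa using this

/-! ### Labels from the relative order of three letters -/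

/-- A label of three consecutive letters: `3` for a peak, `4` for a valley, and `t` if the letters
are monotone. -/
def peakLabel (t x y z : ℕ) : ℕ :=
  if x < y ∧ z < y then 3 else if y < x ∧ y < z then 4 else t

/-- A variant of `peakLabel` that differs from the labels of the triple `A, x, y`. -/
def peakLabelAfter (t A x y z : ℕ) : ℕ :=
  if x < y ∧ y < z ∧ A < x then 4 else
  if z < y ∧ y < x ∧ x < A then 3 else
  if y < z ∧ z < x ∧ A < y then t else
  if x < z ∧ z < y ∧ y < A then t else peakLabel t x y z

theorem peakLabel_mem (t x y z : ℕ) :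
    peakLabel t x y z = t ∨ peakLabel t x y z = 3 ∨ peakLabel t x y z = 4 := by
  unfold peakLabel
  split_ifs <;> simp

theorem peakLabelAfter_mem (t A x y z : ℕ) : peakLabelAfter t A x y z = t ∨
    peakLabelAfter t A x y z = 3 ∨ peakLabelAfter t A x y z = 4 := by
  unfold peakLabelAfter peakLabel
  split_ifs <;> simp

/-- The label is the rank of the middle letter, and rotation changes which letter is in the middle.
-/
theorem peakLabel_rotate {t x y z : ℕ} (ht : t < 3) (hyz : y ≠ z) (hxz : x ≠ z) :
    peakLabel t x y z ≠ peakLabel t y z x := by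
  unfold peakLabel
  split_ifs <;> omega

/-- On a whole triangle the modification is a swap of labels: `t` with 4 if the cyclic order is
increasing and `A` is below all three letters, `t` with 3 if it is decreasing and `A` is above them.
-/
theorem peakLabelAfter_rotate {t A x y z : ℕ} (ht : t < 3) (hxy : x ≠ y) (hyz : y ≠ z)
    (hxz : x ≠ z) : peakLabelAfter t A x y z ≠ peakLabelAfter t A y z x := by
  unfold peakLabelAfter peakLabel
  grind (splits := 20)

theorem peakLabel_shift {t t' x y z u : ℕ} (ht : t < 3) (ht' : t' < 3) (h : t ≠ t') :
    peakLabel t x y z ≠ peakLabel t' y z u := by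
  unfold peakLabel
  split_ifs <;> omega

/-- Here `t = t'` is allowed: both triples are monotone only if `A, x, y, z` is, and then the second
label is 4 or 3 instead. -/
theorem peakLabel_ne_peakLabelAfter {t t' A x y z : ℕ} (ht : t < 3) (ht' : t' < 3)
    (hxy : x ≠ y) (hyz : y ≠ z) (hA : A ≠ x) : peakLabel t A x y ≠ peakLabelAfter t' A x y z := by
  unfold peakLabelAfter peakLabel
  grind (splits := 20)

theorem peakLabelAfter_shift {t t' A x y z u : ℕ} (ht : t < 3) (ht' : t' < 3) (h : t ≠ t') :
    peakLabelAfter t A x y z ≠ peakLabel t' y z u := by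
  unfold peakLabelAfter peakLabel
  grind (splits := 20)

/-- A label of the triple `h, u, v`: the color `c` if `h` is the largest of the three, `d` if it is
the smallest, and `t` otherwise. -/
def hubLabel (t c d h u v : ℕ) : ℕ :=
  if u < h ∧ v < h then c else if h < u ∧ h < v then d else t

/-- A variant of `hubLabel` that differs from the labels of the triple `h, A, u`. -/
def hubLabelAfter (t c d A h u v : ℕ) : ℕ :=
  if u < h ∧ h < v ∧ h < A then d else
  if v < h ∧ h < u ∧ A < h then c else
  if h < v ∧ v < u ∧ v < A then t else
  if u < v ∧ v < h ∧ A < v then t else hubLabel t c d h u v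

theorem hubLabel_mem (t c d h u v : ℕ) : hubLabel t c d h u v = t ∨ hubLabel t c d h u v = c ∨
    hubLabel t c d h u v = d := by
  unfold hubLabel
  split_ifs <;> simp

theorem hubLabelAfter_mem (t c d A h u v : ℕ) : hubLabelAfter t c d A h u v = t ∨
    hubLabelAfter t c d A h u v = c ∨ hubLabelAfter t c d A h u v = d := by
  unfold hubLabelAfter hubLabel
  split_ifs <;> simp

theorem hubLabel_comm (t c d h u v : ℕ) : hubLabel t c d h u v = hubLabel t c d h v u := by
  unfold hubLabel
  simp only [and_comm]

section

variable {t t' c d h u v w A : ℕ}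

theorem hubLabel_rotate (htc : t ≠ c) (htd : t ≠ d) (hcd : c ≠ d) (huv : u ≠ v) (hhu : h ≠ u)
    (hhv : h ≠ v) : hubLabel t c d h u v ≠ hubLabel t c d u v h := by
  unfold hubLabel
  split_ifs <;> omega

/-- Again a swap on whole triangles: `t` with `d` for one cyclic order if the median is below `A`,
`t` with `c` for the other if it is above. -/
theorem hubLabelAfter_rotate (htc : t ≠ c) (htd : t ≠ d) (hcd : c ≠ d) (huv : u ≠ v) (hhu : h ≠ u)
    (hhv : h ≠ v) : hubLabelAfter t c d A h u v ≠ hubLabelAfter t c d A u v h := by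
  unfold hubLabelAfter hubLabel
  grind (splits := 20)

/-- Since `c` and `d` trade roles, a repeated `c` or `d` would compare `h` and `v` both ways. -/
theorem hubLabel_shift (htc : t ≠ c) (htd : t ≠ d) (htc' : t' ≠ c) (htd' : t' ≠ d) (hcd : c ≠ d)
    (htt : t ≠ t') : hubLabel t c d h u v ≠ hubLabel t' d c h v w := by
  unfold hubLabel
  split_ifs <;> omega

theorem hubLabel_ne_hubLabelAfter (htc : t ≠ c) (htd : t ≠ d) (htc' : t' ≠ c) (htd' : t' ≠ d)
    (hcd : c ≠ d) (hhu : h ≠ u) (hhv : h ≠ v) (hA : A ≠ h) :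
    hubLabel t d c h A u ≠ hubLabelAfter t' c d A h u v := by
  unfold hubLabelAfter hubLabel
  grind (splits := 20)

theorem hubLabelAfter_shift (htc : t ≠ c) (htd : t ≠ d) (htc' : t' ≠ c) (htd' : t' ≠ d)
    (hcd : c ≠ d) (htt : t ≠ t') :
    hubLabelAfter t c d A h u v ≠ hubLabel t' d c h v w := by
  unfold hubLabelAfter hubLabel
  grind (splits := 20)

end

/-- A total coloring of the graph from a labelling `lam` of the permutations: an edge of a triangle
has the label of the opposite vertex, and `cB g` is the color of the edge from `g` to
`g * longCycle n`. -/
theorem totalColorable_graph (hn : 3 ≤ n) (cV lam cB : Perm (Fin n) → ℕ)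
    (hV : ∀ g, cV g < 5) (hlam : ∀ g, lam g < 5) (hB : ∀ g, cB g < 5)
    (h : ∀ g, [cV g, lam (g * threeCycle n), lam (g * threeCycle n * threeCycle n), cB g,
      cB (g * (longCycle n)⁻¹)].Nodup)
    (ha : ∀ g, cV g ≠ cV (g * threeCycle n)) (hb : ∀ g, cV g ≠ cV (g * longCycle n)) :
    (graph n).TotalColorable 5 := by
  have h3 : threeCycle n * threeCycle n = (threeCycle n)⁻¹ :=
    eq_inv_of_mul_eq_one_left (threeCycle_pow hn)
  refine SimpleGraph.totalColorable_mulCayley (a := ⟨threeCycle n, threeCycle_mem hn⟩)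
    (b := ⟨longCycle n, longCycle_mem (by omega)⟩) (k := 5) ?_
    -- The third vertex of the triangle on the edge from `g` to `g * a` is `g * a⁻¹`.
    (fun g => ⟨cV g, hV _⟩) (fun g => ⟨lam (g * (threeCycle n)⁻¹), hlam _⟩)
    (fun g => ⟨cB g, hB _⟩) ?_ ?_ ?_
  · rintro ⟨s, hs⟩ hs'
    simpa [generators, permSet, Subtype.ext_iff] using hs'
  · intro g
    have e1 : (g : Perm (Fin n)) * (threeCycle n)⁻¹ * (threeCycle n)⁻¹ = g * threeCycle n := by
      rw [mul_assoc, ← mul_inv_rev, h3, inv_inv]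
    have e2 : (g : Perm (Fin n)) * (threeCycle n)⁻¹ = g * threeCycle n * threeCycle n := by
      rw [mul_assoc, h3]
    have := h g
    refine List.Nodup.of_map Fin.val ?_
    simp only [List.map_cons, List.map_nil, Subgroup.coe_mul, Subgroup.coe_inv, e1]
    rw [e2]
    refine (List.Perm.nodup_iff ?_).1 this
    exact (List.Perm.swap _ _ _).cons _
  · intro g hg
    exact ha g (congrArg Fin.val hg)
  · intro g hg
    exact hb g (congrArg Fin.val hg)

theorem place_mul_inv (g c : Perm (Fin n)) (k : ℕ) :
    place (g * c⁻¹) k = letter c (place g k) := by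
  rw [place_mul, place, inv_inv]

/-! ### The coloring for odd `n` -/

/-- For odd `n`, the color of the edge from `g` to `g * longCycle n` if the letter `n - 1` of `g`
has the place `p`. -/
def oddEdge (n p : ℕ) : ℕ :=
  if p = 0 ∨ p = 2 ∨ p = n then (if n % 3 = 0 then 1 else n % 3) else if p = 1 then 0 else p % 3

/-- The color below `3` missing at the edges of the long cycle. -/
def oddThird (n p : ℕ) : ℕ :=
  if p ≤ 2 then 3 - oddEdge n 0 else 3 - oddEdge n p - oddEdge n (p + 1)

/-- For odd `n`, the color of a word `x, y, z, …, A` with the letter `n - 1` at the place `p`. -/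
def oddColor (n p A x y z : ℕ) : ℕ :=
  if p = 0 then (if y < z then 4 else 3) else
  if p = 1 then oddThird n 1 else
  if p = 2 then (if x < y then 3 else 4) else
  if n % 3 = 0 ∧ p = n - 2 then peakLabelAfter (oddThird n p) A x y z else
  peakLabel (oddThird n p) x y z

theorem oddEdge_lt (n p : ℕ) : oddEdge n p < 3 := by
  unfold oddEdge
  split_ifs <;> omega

/-- The common color at 0, 2 and `n` is nonzero and differs from `(n - 1) % 3`. As 1 and 3 have
color 0, a word with `p ≤ 2` always sees the same two colors. -/
theorem oddEdge_ne {p : ℕ} (hn : 5 ≤ n) (hp : p < n) : oddEdge n p ≠ oddEdge n ((p + 1) % n) := by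
  rcases (by omega : p + 1 = n ∨ p + 1 < n) with h | h
  · rw [h, Nat.mod_self]
    unfold oddEdge
    split_ifs <;> omega
  · rw [Nat.mod_eq_of_lt h]
    unfold oddEdge
    split_ifs <;> first | omega | grind

theorem oddThird_lt (hn : 5 ≤ n) (p : ℕ) : oddThird n p < 3 := by
  unfold oddThird oddEdge
  split_ifs <;> omega

theorem oddThird_ne_oddEdge {p : ℕ} (hn : 5 ≤ n) (hp : p < n) :
    oddThird n p ≠ oddEdge n p ∧ oddThird n p ≠ oddEdge n ((p + 1) % n) := by
  rcases (by omega : p + 1 = n ∨ p + 1 < n) with h | h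
  · rw [h, Nat.mod_self]
    unfold oddThird oddEdge
    split_ifs <;> omega
  · rw [Nat.mod_eq_of_lt h]
    unfold oddThird oddEdge
    split_ifs <;> first | omega | grind

/-- The leftover colors agree only if the edge colors at `p` and `p + 2` do; for `3 ∣ n` this
happens at `n - 2` and `n`, both colored 1. -/
theorem oddThird_succ_ne {p : ℕ} (hp : 3 ≤ p) (hpn : p + 1 < n) (h : ¬ (n % 3 = 0 ∧ p = n - 2)) :
    oddThird n (p + 1) ≠ oddThird n p := by
  unfold oddThird oddEdge
  split_ifs <;> first | omega | grind

theorem oddColor_mem (n p A x y z : ℕ) : oddColor n p A x y z = oddThird n p ∨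
    oddColor n p A x y z = 3 ∨ oddColor n p A x y z = 4 := by
  have h1 : p = 1 → oddThird n 1 = oddThird n p := by rintro rfl; rfl
  unfold oddColor
  split_ifs
  all_goals first
    | exact .inl (h1 ‹_›)
    | simp
    | exact peakLabelAfter_mem _ _ _ _ _
    | exact peakLabel_mem _ _ _ _

theorem oddColor_rotate {p A x y z : ℕ} (hn : 5 ≤ n) (hxy : x ≠ y) (hyz : y ≠ z) (hxz : x ≠ z) :
    oddColor n p A x y z ≠ oddColor n (if p < 3 then (p + 2) % 3 else p) A y z x := by
  have ht := oddThird_lt hn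
  have h1 := ht 1
  rcases (by omega : p = 0 ∨ p = 1 ∨ p = 2 ∨ 3 ≤ p) with rfl | rfl | rfl | h
  · simp [oddColor]
    split_ifs <;> omega
  · simp [oddColor]
    split_ifs <;> omega
  · simp [oddColor]
    split_ifs <;> omega
  · rw [if_neg (by omega)]
    have h0 : p ≠ 0 := by omega
    have h1 : p ≠ 1 := by omega
    have h2 : p ≠ 2 := by omega
    simp only [oddColor, if_neg h0, if_neg h1, if_neg h2]
    split_ifs
    · exact peakLabelAfter_rotate (ht p) hxy hyz hxz
    · exact peakLabel_rotate (ht p) hyz hxz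

theorem oddColor_shift {p A x y z u : ℕ} (hn : 5 ≤ n) (hp : p < n) (hxy : x ≠ y)
    (hyz : y ≠ z) (hzu : z ≠ u) :
    oddColor n p A x y z ≠ oddColor n (if p = 0 then n - 1 else p - 1) x y z u := by
  have ht := oddThird_lt hn
  have h1 := ht 1
  rcases (by omega : p = 0 ∨ p = 1 ∨ p = 2 ∨ p = 3 ∨ 4 ≤ p) with rfl | rfl | rfl | rfl | h
  · rw [if_pos rfl]
    have h0 : n - 1 ≠ 0 := by omega
    have h1 : n - 1 ≠ 1 := by omega
    have h2 : n - 1 ≠ 2 := by omega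
    have h3 : ¬ (n % 3 = 0 ∧ n - 1 = n - 2) := by omega
    simp only [oddColor, if_true, if_neg h0, if_neg h1, if_neg h2, if_neg h3]
    have := ht (n - 1)
    unfold peakLabel
    split_ifs <;> omega
  · simp [oddColor]
    split_ifs <;> omega
  · simp [oddColor]
    split_ifs <;> omega
  · have := ht 3
    have h5 : ¬ (n % 3 = 0 ∧ 3 = n - 2) := by omega
    simp [oddColor, h5]
    unfold peakLabel
    split_ifs <;> omega
  · obtain ⟨p, rfl⟩ : ∃ q, p = q + 1 := ⟨p - 1, by omega⟩
    rw [if_neg (by omega), Nat.add_sub_cancel]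
    have h0 : p ≠ 0 := by omega
    have h1 : p ≠ 1 := by omega
    have h2 : p ≠ 2 := by omega
    have h0' : p + 1 ≠ 0 := by omega
    have h1' : p + 1 ≠ 1 := by omega
    have h2' : p + 1 ≠ 2 := by omega
    simp only [oddColor, if_neg h0, if_neg h1, if_neg h2, if_neg h0', if_neg h1', if_neg h2']
    by_cases hm : n % 3 = 0 ∧ p = n - 2
    · rw [if_neg (by omega), if_pos hm]
      exact peakLabel_ne_peakLabelAfter (ht _) (ht _) hyz hzu hxy
    · rw [if_neg hm]
      have := oddThird_succ_ne (n := n) (p := p) (by omega) hp hm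
      split_ifs
      · exact peakLabelAfter_shift (ht _) (ht _) this
      · exact peakLabel_shift (ht _) (ht _) this

theorem totalColorable_graph_of_odd (hn : 5 ≤ n) (hodd : Odd n) : (graph n).TotalColorable 5 := by
  let c : Perm (Fin n) → ℕ := fun g =>
    oddColor n (place g (n - 1)) (letter g (n - 1)) (letter g 0) (letter g 1) (letter g 2)
  have hlt : ∀ g, c g < 5 := by
    intro g
    have h1 := oddColor_mem n (place g (n - 1)) (letter g (n - 1)) (letter g 0) (letter g 1)
      (letter g 2)
    have h2 := oddThird_lt hn (place g (n - 1))
    simp only [c]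
    omega
  have hp : ∀ g : Perm (Fin n), place g (n - 1) < n := fun g => place_lt g (by omega)
  have hrot : ∀ g, c g ≠ c (g * threeCycle n) := by
    intro g
    have e := oddColor_rotate (n := n) (p := place g (n - 1)) (A := letter g (n - 1)) hn
      (letter_ne g zero_ne_one) (letter_ne g (by decide : 1 ≠ 2)) (letter_ne g (by decide : 0 ≠ 2))
    simp only [c, letter_mul, place_mul, letter_threeCycle (by omega : 3 ≤ n),
      place_threeCycle (by omega : 3 ≤ n)]
    rw [if_neg (by omega : ¬ n - 1 < 3)]
    simpa using e
  -- The leftover color is constant on triangles, so their labels come from one set of three colors.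
  have hthird : ∀ g : Perm (Fin n), oddThird n (place (g * threeCycle n) (n - 1)) =
      oddThird n (place g (n - 1)) := by
    intro g
    rw [place_mul, place_threeCycle (by omega)]
    split_ifs with h
    · unfold oddThird
      rw [if_pos (by omega), if_pos (by omega)]
    · rfl
  refine totalColorable_graph (by omega) c c (fun g => oddEdge n (place g (n - 1))) hlt hlt
    (fun g => (oddEdge_lt _ _).trans (by decide)) ?_ hrot ?_
  · intro g
    have r1 := hrot g
    have r2 := hrot (g * threeCycle n)
    have r3 := hrot (g * threeCycle n * threeCycle n)
    have e3 : g * threeCycle n * threeCycle n * threeCycle n = g := by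
      rw [mul_assoc, mul_assoc, ← mul_assoc (threeCycle n), threeCycle_pow (by omega), mul_one]
    rw [e3] at r3
    have m0 := oddColor_mem n (place g (n - 1)) (letter g (n - 1)) (letter g 0) (letter g 1)
      (letter g 2)
    have hmem : ∀ g, c g = oddThird n (place g (n - 1)) ∨ c g = 3 ∨ c g = 4 :=
      fun g => oddColor_mem _ _ _ _ _ _
    have m1 := hmem g
    have m2 := hmem (g * threeCycle n)
    have m3 := hmem (g * threeCycle n * threeCycle n)
    rw [hthird] at m2 m3
    rw [hthird] at m3
    obtain ⟨t1, t2⟩ := oddThird_ne_oddEdge hn (hp g)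
    have t3 := oddEdge_ne hn (hp g)
    have l1 := oddEdge_lt n (place g (n - 1))
    have l2 := oddEdge_lt n ((place g (n - 1) + 1) % n)
    simp only [place_mul_inv, letter_longCycle_of_odd hodd (hp g)]
    simp only [List.nodup_cons, List.mem_cons, List.not_mem_nil, or_false, not_or,
      not_false_eq_true, List.nodup_nil, and_true]
    omega
  · intro g
    have e := oddColor_shift (n := n) (p := place g (n - 1)) (A := letter g (n - 1)) hn (hp g)
      (letter_ne g zero_ne_one) (letter_ne g (by decide : 1 ≠ 2)) (letter_ne g (by decide : 2 ≠ 3))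
    simp only [c, letter_mul, place_mul, place_longCycle_of_odd hodd (hp g)]
    rw [letter_longCycle_of_odd hodd (by omega : n - 1 < n),
      letter_longCycle_of_odd hodd (by omega : 0 < n),
      letter_longCycle_of_odd hodd (by omega : 1 < n),
      letter_longCycle_of_odd hodd (by omega : 2 < n), Nat.sub_add_cancel (by omega), Nat.mod_self,
      Nat.mod_eq_of_lt (by omega : 0 + 1 < n), Nat.mod_eq_of_lt (by omega : 1 + 1 < n),
      Nat.mod_eq_of_lt (by omega : 2 + 1 < n)]
    exact e

/-! ### The coloring for even `n ≥ 6` -/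

/-- For even `n`, the color of the edge from `g` to `g * longCycle n` if the letter `n - 1` of `g`
has the place `p ≠ 0`. -/
def evenEdge (n p : ℕ) : ℕ :=
  if p = 1 then 0 else if p = 2 then 3 else
  if p ≤ 5 ∨ n % 3 = 0 then 2 * p % 3 else if n % 3 = 2 then (2 * p + 2) % 3 else
  if p = 6 then 2 else (2 * p + 1) % 3

/-- For even `n`, the color of the edge from `g` to `g * longCycle n` if the letters `n - 1` and
`n - 2` of `g` have the places `p` and `q`. -/
def evenEdge' (n p q : ℕ) : ℕ :=
  if p = 0 then (if q = 2 then 4 else if q % 2 = 1 ∧ q ≠ 1 then 3 else 0) else evenEdge n p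

/-- The color below `3` missing at the edges of the long cycle. -/
def evenThird (n p : ℕ) : ℕ := 3 - evenEdge n p - evenEdge n (p + 1)

/-- The place of the letter `n - 2` in the rotation of the word that moves the letter `n - 1` from
its place `p ≤ 2` to the place `0`. -/
def rotatedPlace (p q : ℕ) : ℕ := if q < 3 then (q + 3 - p) % 3 else q

/-- For even `n`, the label of a word `h, u, v, E, …, A` with the letters `n - 1` and `n - 2` at the
places `p` and `q`. -/
def evenLabel (n p q A h u v E : ℕ) : ℕ :=
  if p ≤ 2 then
    if rotatedPlace p q % 2 = 1 ∨ rotatedPlace p q = 2 then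
      if p = 0 then 4 else p
    else if p = 0 then (if u < v then 1 else 2)
    else if p = 1 then (if v < h then 4 else 1)
    else (if h < u then 2 else 4)
  else
    if n % 3 ≠ 0 ∧ p = 4 then hubLabelAfter (evenThird n p) (4 - p % 2) (3 + p % 2) A h u v else
    if n % 3 = 2 ∧ p = 6 ∨ n % 3 = 1 ∧ p = 7 then
      hubLabelAfter (evenThird n p) (4 - p % 2) (3 + p % 2) E h v u
    else hubLabel (evenThird n p) (4 - p % 2) (3 + p % 2) h u v

/-- For even `n`, the color of a word. It differs from the label only if the letters `n - 1` and
`n - 2` have the places `0` and `1` or `0` and `2`. -/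
def evenColor (n p q A h u v E : ℕ) : ℕ :=
  if p = 0 ∧ q = 1 then 3 else if p = 0 ∧ q = 2 then 0 else evenLabel n p q A h u v E

theorem evenEdge_lt {p : ℕ} (hp : 3 ≤ p) : evenEdge n p < 3 := by
  unfold evenEdge
  split_ifs <;> omega

/-- This closes the cycle of the places `1, …, n - 1`: place 1 has color 0 too. The residue of `n`
mod 3 dictates the breaks in the pattern 0, 2, 1. -/
theorem evenEdge_self (hn : 6 ≤ n) (hn2 : n % 2 = 0) : evenEdge n n = 0 := by
  unfold evenEdge
  split_ifs <;> omega

theorem evenEdge_mod (hn : 6 ≤ n) (hn2 : n % 2 = 0) {p : ℕ} (hp : p < n) :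
    evenEdge n (p % (n - 1) + 1) = evenEdge n (p + 1) := by
  rcases (by omega : p = n - 1 ∨ p < n - 1) with rfl | h
  · rw [Nat.mod_self, Nat.sub_add_cancel (by omega), evenEdge_self hn hn2]
    rfl
  · rw [Nat.mod_eq_of_lt h]

theorem evenEdge_ne {p : ℕ} (hp : 3 ≤ p) : evenEdge n p ≠ evenEdge n (p + 1) := by
  unfold evenEdge
  split_ifs <;> omega

theorem evenThird_lt {p : ℕ} (hp : 3 ≤ p) : evenThird n p < 3 := by
  have h1 := evenEdge_lt (n := n) hp
  have h2 := evenEdge_lt (n := n) (p := p + 1) (by omega)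
  have h3 := evenEdge_ne (n := n) hp
  unfold evenThird
  omega

theorem evenThird_ne {p : ℕ} (hp : 3 ≤ p) :
    evenThird n p ≠ evenEdge n p ∧ evenThird n p ≠ evenEdge n (p + 1) := by
  have h1 := evenEdge_lt (n := n) hp
  have h2 := evenEdge_lt (n := n) (p := p + 1) (by omega)
  have h3 := evenEdge_ne (n := n) hp
  unfold evenThird
  omega

theorem evenThird_three : evenThird n 3 = 1 := by
  unfold evenThird evenEdge
  simp

theorem evenThird_pred (hn : 6 ≤ n) (hn2 : n % 2 = 0) : evenThird n (n - 1) = 2 := by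
  unfold evenThird
  rw [Nat.sub_add_cancel (by omega), evenEdge_self hn hn2]
  unfold evenEdge
  split_ifs <;> omega

/-- The exceptions are the places where a break in the pattern gives `p` and `p + 2` the same edge
color. -/
theorem evenThird_succ_ne {p : ℕ} (hp : 3 ≤ p) (h4 : ¬ (n % 3 ≠ 0 ∧ p = 4))
    (h5 : ¬ (n % 3 = 2 ∧ p = 5)) (h6 : ¬ (n % 3 = 1 ∧ p = 6)) :
    evenThird n (p + 1) ≠ evenThird n p := by
  unfold evenThird evenEdge
  split_ifs <;> omega

theorem evenLabel_mem_of_le {p : ℕ} (hp : p ≤ 2) (n q A h u v E : ℕ) :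
    evenLabel n p q A h u v E = 1 ∨ evenLabel n p q A h u v E = 2 ∨
      evenLabel n p q A h u v E = 4 := by
  unfold evenLabel
  split_ifs <;> omega

theorem evenLabel_mem_of_lt {p : ℕ} (hp : 2 < p) (n q A h u v E : ℕ) :
    evenLabel n p q A h u v E = evenThird n p ∨ evenLabel n p q A h u v E = 3 ∨
      evenLabel n p q A h u v E = 4 := by
  unfold evenLabel
  have h1 := hubLabelAfter_mem (evenThird n p) (4 - p % 2) (3 + p % 2) A h u v
  have h2 := hubLabelAfter_mem (evenThird n p) (4 - p % 2) (3 + p % 2) E h v u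
  have h3 := hubLabel_mem (evenThird n p) (4 - p % 2) (3 + p % 2) h u v
  split_ifs <;> omega

theorem evenLabel_rotate {p q A h u v E : ℕ} (huv : u ≠ v) (hhu : h ≠ u) (hhv : h ≠ v) :
    evenLabel n p q A h u v E ≠ evenLabel n (if p < 3 then (p + 2) % 3 else p)
      (if q < 3 then (q + 2) % 3 else q) A u v h E := by
  rcases Nat.lt_or_ge p 3 with hp | hp
  · have e : rotatedPlace ((p + 2) % 3) (if q < 3 then (q + 2) % 3 else q) = rotatedPlace p q := by
      unfold rotatedPlace
      split_ifs <;> omega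
    rw [if_pos hp]
    unfold evenLabel
    rw [e]
    interval_cases p <;> simp <;> split_ifs <;> omega
  · have ht := evenThird_lt (n := n) hp
    have hp' : ¬ p ≤ 2 := by omega
    rw [if_neg (by omega)]
    simp only [evenLabel, if_neg hp']
    split_ifs
    · exact hubLabelAfter_rotate (by omega) (by omega) (by omega) huv hhu hhv
    · exact (hubLabelAfter_rotate (by omega) (by omega) (by omega) hhv.symm.symm hhu.symm
        huv).symm
    · exact hubLabel_rotate (by omega) (by omega) (by omega) huv hhu hhv

/-- The clash between places 5 and 4 is repaired at 4, looking back to the last letter. The second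
clash is repaired at its larger place, looking ahead to the fourth letter, hence with `u` and `v`
reversed. -/
theorem evenLabel_shift_of_lt {p q q' A h u v w E : ℕ} (hp : 3 ≤ p)
    (hhu : h ≠ u) (hhv : h ≠ v) (hhw : h ≠ w) :
    evenLabel n (p + 1) q A h u v w ≠ evenLabel n p q' u h v w E := by
  have ht := evenThird_lt (n := n) hp
  have ht' := evenThird_lt (n := n) (p := p + 1) (by omega)
  have hp1 : ¬ p ≤ 2 := by omega
  have hp2 : ¬ p + 1 ≤ 2 := by omega
  have e1 : 4 - (p + 1) % 2 = 3 + p % 2 := by omega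
  have e2 : 3 + (p + 1) % 2 = 4 - p % 2 := by omega
  simp only [evenLabel, if_neg hp1, if_neg hp2, e1, e2]
  have hne := evenThird_succ_ne (n := n) hp
  by_cases h1 : n % 3 ≠ 0 ∧ p = 4
  · rw [if_pos h1, if_neg (by omega), if_neg (by omega)]
    exact hubLabel_ne_hubLabelAfter (by omega) (by omega) (by omega) (by omega) (by omega) hhv hhw
      hhu.symm
  rw [if_neg h1]
  by_cases h2 : n % 3 = 2 ∧ p + 1 = 6 ∨ n % 3 = 1 ∧ p + 1 = 7
  · rw [if_neg (by omega), if_pos h2, if_neg (by omega), hubLabel_comm _ _ _ _ v]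
    exact (hubLabel_ne_hubLabelAfter (by omega) (by omega) (by omega) (by omega) (by omega) hhv hhu
      hhw.symm).symm
  rw [if_neg h2]
  have htt := hne h1 (by omega) (by omega)
  by_cases h3 : n % 3 = 2 ∧ p = 6 ∨ n % 3 = 1 ∧ p = 7
  · rw [if_neg (by omega), if_pos h3, hubLabel_comm]
    exact (hubLabelAfter_shift (by omega) (by omega) (by omega) (by omega) (by omega)
      htt.symm).symm
  rw [if_neg h3]
  split_ifs
  · exact hubLabelAfter_shift (by omega) (by omega) (by omega) (by omega) (by omega) htt
  · exact hubLabel_shift (by omega) (by omega) (by omega) (by omega) (by omega) htt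

/-- For `p = 0` the colors on the odd cycle `q = 1, …, n - 1` are 3, 0, then 4 at odd `q` and 1 or 2
at even `q`. -/
theorem evenColor_shift {p q A h u v w E : ℕ} (hn : 6 ≤ n) (hn2 : n % 2 = 0) (hp : p < n)
    (hq : q < n) (hpq : p ≠ q) (hhu : h ≠ u) (hhv : h ≠ v) (hhw : h ≠ w) :
    evenColor n p q A h u v w ≠
      evenColor n (if p = 0 then 0 else if p = 1 then n - 1 else p - 1)
        (if q = 0 then 0 else if q = 1 then n - 1 else q - 1) u h v w E := by
  rcases (by omega : p = 0 ∨ p = 1 ∨ p = 2 ∨ p = 3 ∨ 4 ≤ p) with rfl | rfl | rfl | rfl | hp4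
  · rcases (by omega : q = 1 ∨ q = 2 ∨ q = 3 ∨ 4 ≤ q) with rfl | rfl | rfl | hq
    · have e1 : (n - 1) % 2 = 1 := by omega
      have e2 : n - 1 ≠ 1 := by omega
      have e3 : n - 1 ≠ 2 := by omega
      have e4 : ¬ n - 1 < 3 := by omega
      simp [evenColor, evenLabel, rotatedPlace, e1, e2, e3, e4]
    · simp [evenColor]
    · simp [evenColor, evenLabel, rotatedPlace]
    · have e0 : q ≠ 0 := by omega
      have e1 : q ≠ 1 := by omega
      have e2 : q - 1 ≠ 1 := by omega
      have e3 : q - 1 ≠ 2 := by omega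
      have e4 : ¬ q - 1 < 3 := by omega
      have e5 : ¬ q < 3 := by omega
      have e6 : q ≠ 2 := by omega
      simp only [evenColor, evenLabel, rotatedPlace, e0, e1, e2, e3, e4, e5, e6, if_true, if_false,
        and_false, or_false, zero_le]
      split_ifs <;> omega
  -- The next place `n - 1` is odd with leftover color 2, so only 4 could repeat, which needs both
  -- `v < h` and `h < v`.
  · have e1 : n - 1 ≠ 0 := by omega
    have e2 : ¬ n - 1 ≤ 2 := by omega
    have e3 : n - 1 ≠ 4 := by omega
    have e4 : ¬ (n % 3 = 2 ∧ n - 1 = 6 ∨ n % 3 = 1 ∧ n - 1 = 7) := by omega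
    have e5 : (n - 1) % 2 = 1 := by omega
    simp only [evenColor, evenLabel, one_ne_zero, e1, e2, e3, e4, e5, evenThird_pred hn hn2, if_true,
      if_false, and_false, false_and]
    unfold hubLabel
    split_ifs <;> omega
  -- Color 4 at place 2 needs an even `q ≥ 4`; then `q - 1` is odd and the next color is 1.
  · simp [evenColor, evenLabel]
    unfold rotatedPlace
    split_ifs <;> omega
  · have e1 : ¬ (n % 3 = 2 ∧ 3 = 6 ∨ n % 3 = 1 ∧ 3 = 7) := by omega
    simp [evenColor, evenLabel, evenThird_three]
    unfold hubLabel
    split_ifs <;> omega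
  · obtain ⟨p, rfl⟩ : ∃ q, p = q + 1 := ⟨p - 1, by omega⟩
    have e0 : p ≠ 0 := by omega
    simp only [evenColor, e0, Nat.add_eq_zero_iff, one_ne_zero, and_false, false_and, if_false,
      Nat.add_sub_cancel, Nat.add_eq_right]
    exact evenLabel_shift_of_lt (by omega) hhu hhv hhw

-- For `p = 0` the long-cycle edges with `q = 1, …, n - 1` are colored 0, 4, 3, 0, 3, …, 0, 3; the 4
-- is needed because this cycle is odd.
set_option maxHeartbeats 1000000 in
theorem totalColorable_graph_of_even (hn : 6 ≤ n) (heven : Even n) :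
    (graph n).TotalColorable 5 := by
  have hn2 : n % 2 = 0 := Nat.even_iff.1 heven
  let f : (ℕ → ℕ → ℕ → ℕ → ℕ → ℕ → ℕ → ℕ → ℕ) → Perm (Fin n) → ℕ := fun k g =>
    k n (place g (n - 1)) (place g (n - 2)) (letter g (n - 1)) (letter g 0) (letter g 1)
      (letter g 2) (letter g 3)
  have hp : ∀ g : Perm (Fin n), place g (n - 1) < n := fun g => place_lt g (by omega)
  have hq : ∀ g : Perm (Fin n), place g (n - 2) < n := fun g => place_lt g (by omega)
  have hpq : ∀ g : Perm (Fin n), place g (n - 1) ≠ place g (n - 2) :=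
    fun g => letter_ne _ (by omega)
  have hmem : ∀ g, place g (n - 1) ≤ 2 ∧ (f evenLabel g = 1 ∨ f evenLabel g = 2 ∨
        f evenLabel g = 4) ∨ 3 ≤ place g (n - 1) ∧ (f evenLabel g = evenThird n (place g (n - 1)) ∨
        f evenLabel g = 3 ∨ f evenLabel g = 4) := by
    intro g
    rcases Nat.lt_or_ge 2 (place g (n - 1)) with h | h
    · exact .inr ⟨h, evenLabel_mem_of_lt h _ _ _ _ _ _ _⟩
    · exact .inl ⟨h, evenLabel_mem_of_le h _ _ _ _ _ _ _⟩
  have hplace : ∀ (g : Perm (Fin n)) k, place (g * threeCycle n) k =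
      if place g k < 3 then (place g k + 2) % 3 else place g k := by
    intro g k
    rw [place_mul, place_threeCycle (by omega)]
  have hrot : ∀ g, f evenLabel g ≠ f evenLabel (g * threeCycle n) := by
    intro g
    have e := evenLabel_rotate (n := n) (p := place g (n - 1)) (q := place g (n - 2))
      (A := letter g (n - 1)) (E := letter g 3)
      (letter_ne g (by decide : 1 ≠ 2)) (letter_ne g zero_ne_one) (letter_ne g (by decide : 0 ≠ 2))
    simp only [f, letter_mul, hplace, letter_threeCycle (by omega : 3 ≤ n)]
    rw [if_neg (by omega : ¬ n - 1 < 3)]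
    simpa using e
  have hmem' : ∀ g, place g (n - 1) ≤ 2 ∧ (f evenLabel (g * threeCycle n) = 1 ∨
        f evenLabel (g * threeCycle n) = 2 ∨ f evenLabel (g * threeCycle n) = 4) ∨
      3 ≤ place g (n - 1) ∧ (f evenLabel (g * threeCycle n) = evenThird n (place g (n - 1)) ∨
        f evenLabel (g * threeCycle n) = 3 ∨ f evenLabel (g * threeCycle n) = 4) := by
    intro g
    have m := hmem (g * threeCycle n)
    rw [hplace] at m
    split_ifs at m with h
    · exact .inl ⟨by omega, by omega⟩
    · exact .inr ⟨by omega, by omega⟩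
  have hV : ∀ g, place g (n - 1) = 0 ∧ place g (n - 2) = 1 ∧ f evenColor g = 3 ∨
      place g (n - 1) = 0 ∧ place g (n - 2) = 2 ∧ f evenColor g = 0 ∨
      ¬ (place g (n - 1) = 0 ∧ (place g (n - 2) = 1 ∨ place g (n - 2) = 2)) ∧
        f evenColor g = f evenLabel g := by
    intro g
    simp only [f, evenColor]
    split_ifs <;> omega
  have ht : ∀ g : Perm (Fin n), 3 ≤ place g (n - 1) → evenThird n (place g (n - 1)) < 3 :=
    fun g => evenThird_lt
  have hlam : ∀ g, f evenLabel g < 5 := by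
    intro g
    have h1 := hmem g
    have h2 := ht g
    omega
  refine totalColorable_graph (by omega) (f evenColor) (f evenLabel)
    (fun g => evenEdge' n (place g (n - 1)) (place g (n - 2))) ?_ hlam ?_ ?_ ?_ ?_
  · intro g
    have h1 := hV g
    have h2 := hlam g
    omega
  · intro g
    have := evenEdge_lt (n := n) (p := place g (n - 1))
    simp only [evenEdge']
    split_ifs
    · omega
    · omega
    · omega
    · rcases (by omega : place g (n - 1) = 1 ∨ place g (n - 1) = 2 ∨ 3 ≤ place g (n - 1)) with
        h | h | h
      · simp [h, evenEdge]
      · simp [h, evenEdge]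
      · omega
  · intro g
    have r1 := hrot g
    have r2 := hrot (g * threeCycle n)
    have r3 := hrot (g * threeCycle n * threeCycle n)
    have e3 : g * threeCycle n * threeCycle n * threeCycle n = g := by
      rw [mul_assoc, mul_assoc, ← mul_assoc (threeCycle n), threeCycle_pow (by omega), mul_one]
    rw [e3] at r3
    have m1 := hmem g
    have m2 := hmem' g
    have m3 : place g (n - 1) ≤ 2 ∧ (f evenLabel (g * threeCycle n * threeCycle n) = 1 ∨
          f evenLabel (g * threeCycle n * threeCycle n) = 2 ∨
          f evenLabel (g * threeCycle n * threeCycle n) = 4) ∨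
        3 ≤ place g (n - 1) ∧
          (f evenLabel (g * threeCycle n * threeCycle n) = evenThird n (place g (n - 1)) ∨
          f evenLabel (g * threeCycle n * threeCycle n) = 3 ∨
          f evenLabel (g * threeCycle n * threeCycle n) = 4) := by
      have m := hmem' (g * threeCycle n)
      rw [hplace] at m
      split_ifs at m with h
      · exact .inl ⟨by omega, by omega⟩
      · exact .inr ⟨by omega, by omega⟩
    have v1 := hV g
    -- A recolored vertex has label 4, so its triangle edges have colors 1 and 2. Its long-cycle
    -- edges have 0, 4 or 4, 3, which leaves 3 or 0.
    have h4 : place g (n - 1) = 0 → place g (n - 2) = 1 ∨ place g (n - 2) = 2 →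
        f evenLabel g = 4 := by
      intro e0 e1
      rcases e1 with e1 | e1 <;> simp [f, e0, e1, evenLabel, rotatedPlace]
    have hp' := hp g
    have hq' := hq g
    have hpq' := hpq g
    simp only [place_mul_inv, List.nodup_cons, List.mem_cons, List.not_mem_nil, or_false, not_or,
      not_false_eq_true, List.nodup_nil, and_true]
    generalize f evenLabel g = x1, f evenLabel (g * threeCycle n) = x2,
      f evenLabel (g * threeCycle n * threeCycle n) = x3, f evenColor g = y at r1 r2 r3 m1 m2 m3 v1 h4 ⊢
    clear hmem hmem' hrot hV ht hlam hplace hp hq hpq e3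
    generalize place g (n - 1) = p at *
    generalize place g (n - 2) = q at *
    rcases (by omega : p = 0 ∨ p = 1 ∨ p = 2 ∨ 3 ≤ p) with rfl | rfl | rfl | h
    · have h4' := h4 rfl
      rw [letter_longCycle_zero_of_even heven, letter_longCycle_of_even heven (by omega) hq']
      simp only [evenEdge', if_true]
      rcases (by omega : q = n - 1 ∨ q < n - 1) with rfl | hq''
      · rw [Nat.mod_self]
        split_ifs <;> first | omega | (simp only [not_false_eq_true, and_true]; omega)
      · rw [Nat.mod_eq_of_lt hq'']
        split_ifs <;> first | omega | (simp only [not_false_eq_true, and_true]; omega)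
    · rw [letter_longCycle_of_even heven (by omega) hp', Nat.mod_eq_of_lt (by omega)]
      simp only [evenEdge', evenEdge]
      norm_num
      omega
    · rw [letter_longCycle_of_even heven (by omega) hp', Nat.mod_eq_of_lt (by omega)]
      simp only [evenEdge', evenEdge]
      norm_num
      omega
    · rw [letter_longCycle_of_even heven (by omega) hp']
      simp only [evenEdge', if_neg (by omega : ¬ p = 0), Nat.succ_ne_zero, if_false,
        evenEdge_mod hn hn2 hp']
      have hle : ¬ p ≤ 2 := by omega
      replace m1 := (m1.resolve_left (fun e => hle e.1)).2
      replace m2 := (m2.resolve_left (fun e => hle e.1)).2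
      replace m3 := (m3.resolve_left (fun e => hle e.1)).2
      obtain rfl : y = x1 := by
        clear m1 m2 m3 r1 r2 r3
        omega
      have t1 := evenThird_lt (n := n) h
      have t2 := evenThird_ne (n := n) h
      have t3 := evenEdge_ne (n := n) h
      have t4 := evenEdge_lt (n := n) h
      have t5 := evenEdge_lt (n := n) (p := p + 1) (by omega)
      clear v1 h4
      refine ⟨⟨r1, r3.symm, ?_, ?_⟩, ⟨?_, ?_, ?_⟩, ⟨?_, ?_⟩, ?_⟩ <;> omega
  · intro g
    have r1 := hrot g
    have v1 := hV g
    have v2 := hV (g * threeCycle n)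
    have m1 := hmem g
    have m2 := hmem' g
    have hpq' := hpq g
    have hp' := hplace g (n - 1)
    have hq' := hplace g (n - 2)
    generalize f evenLabel g = x1, f evenLabel (g * threeCycle n) = x2, f evenColor g = y1,
      f evenColor (g * threeCycle n) = y2, place (g * threeCycle n) (n - 1) = p2,
      place (g * threeCycle n) (n - 2) = q2, place g (n - 1) = p, place g (n - 2) = q
      at r1 v1 v2 m1 m2 hpq' hp' hq' ⊢
    clear hmem hmem' hrot hV ht hlam hplace hp hq hpq
    rcases (by omega : p = 0 ∨ p = 1 ∨ p = 2 ∨ 3 ≤ p) with rfl | rfl | rfl | h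
    · norm_num at hp'
      omega
    · norm_num at hp'
      split_ifs at hq' <;> omega
    · norm_num at hp'
      omega
    · rw [if_neg (by omega)] at hp'
      omega
  · intro g
    have e := evenColor_shift (n := n) (A := letter g (n - 1)) (E := letter g 4) hn hn2 (hp g)
      (hq g) (hpq g) (letter_ne g zero_ne_one) (letter_ne g (by decide : 0 ≠ 2))
      (letter_ne g (by decide : 0 ≠ 3))
    simp only [f, letter_mul, place_mul, place_longCycle_of_even heven (by omega) (hp g),
      place_longCycle_of_even heven (by omega) (hq g)]
    rw [letter_longCycle_of_even heven (by omega) (by omega : n - 1 < n),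
      letter_longCycle_zero_of_even heven,
      letter_longCycle_of_even heven (by omega) (by omega : 1 < n),
      letter_longCycle_of_even heven (by omega) (by omega : 2 < n),
      letter_longCycle_of_even heven (by omega) (by omega : 3 < n), Nat.mod_self,
      Nat.mod_eq_of_lt (by omega : 1 < n - 1), Nat.mod_eq_of_lt (by omega : 2 < n - 1),
      Nat.mod_eq_of_lt (by omega : 3 < n - 1)]
    exact e

/-! ### The case `n = 4` -/

theorem totalColorable_graph_four : (graph 4).TotalColorable 5 := by
  -- An even permutation of four points is determined by two of its values; the diagonals of the
  -- tables are never read.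
  let f : (Fin 4 → Fin 4 → Fin 5) → alternatingGroup (Fin 4) → Fin 5 := fun t g => t (g.1 0) (g.1 1)
  refine SimpleGraph.totalColorable_mulCayley (a := ⟨threeCycle 4, threeCycle_mem (by omega)⟩)
    (b := ⟨longCycle 4, longCycle_mem (by omega)⟩) ?_
    (f ![![0, 4, 3, 1], ![4, 0, 1, 0], ![3, 4, 0, 1], ![4, 0, 1, 0]])
    (fun g => f ![![0, 0, 0, 1], ![2, 0, 1, 0], ![2, 3, 0, 1], ![2, 0, 1, 0]]
      (g * ⟨threeCycle 4, threeCycle_mem (by omega)⟩⁻¹))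
    (f ![![0, 0, 4, 3], ![2, 0, 3, 4], ![2, 3, 0, 4], ![2, 3, 4, 0]]) ?_ ?_ ?_
  · rintro ⟨s, hs⟩ hs'
    simpa [generators, permSet, Subtype.ext_iff] using hs'
  all_goals decide +kernel

theorem totalColorable_graph_five (hn : 4 ≤ n) : (graph n).TotalColorable 5 := by
  rcases n.even_or_odd with h | h
  · rcases (by have := Nat.even_iff.1 h; omega : n = 4 ∨ 6 ≤ n) with rfl | h6
    · exact totalColorable_graph_four
    · exact totalColorable_graph_of_even h6 h
  · exact totalColorable_graph_of_odd (by have := Nat.odd_iff.1 h; omega) h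

/-! ### The graph is 4-regular -/

theorem letter_longCycle_one (hn : 4 ≤ n) : letter (longCycle n) 1 = 2 := by
  rcases n.even_or_odd with h | h
  · rw [letter_longCycle_of_even h one_pos (by omega), Nat.mod_eq_of_lt (by omega)]
  · rw [letter_longCycle_of_odd h (by omega), Nat.mod_eq_of_lt (by omega)]

theorem letter_longCycle_two (hn : 4 ≤ n) : letter (longCycle n) 2 = 3 := by
  rcases n.even_or_odd with h | h
  · rw [letter_longCycle_of_even h two_pos (by omega), Nat.mod_eq_of_lt (by omega)]
  · rw [letter_longCycle_of_odd h (by omega), Nat.mod_eq_of_lt (by omega)]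

theorem ne_of_letter_ne {g h : Perm (Fin n)} (i : ℕ) (e : letter g i ≠ letter h i) : g ≠ h := by
  rintro rfl
  exact e rfl

theorem nodup_threeCycle_longCycle (hn : 4 ≤ n) :
    [1, threeCycle n, (threeCycle n)⁻¹, longCycle n, (longCycle n)⁻¹].Nodup := by
  have ha := letter_threeCycle (by omega : 3 ≤ n)
  have h1 := letter_longCycle_one hn
  have h2 := letter_longCycle_two hn
  have a0 : letter (threeCycle n)⁻¹ 0 = 2 := (letter_inv_eq_iff _).2 (ha 2)
  have a2 : letter (threeCycle n)⁻¹ 2 = 1 := (letter_inv_eq_iff _).2 (ha 1)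
  have b2 : letter (longCycle n)⁻¹ 2 = 1 := (letter_inv_eq_iff _).2 h1
  have b3 : letter (longCycle n)⁻¹ 3 = 2 := (letter_inv_eq_iff _).2 h2
  have a3 : letter (threeCycle n)⁻¹ 3 = 3 := (letter_inv_eq_iff _).2 (ha 3)
  simp only [List.nodup_cons, List.mem_cons, List.not_mem_nil, or_false, not_or,
    not_false_eq_true, List.nodup_nil, and_true]
  refine ⟨⟨?_, ?_, ?_, ?_⟩, ⟨?_, ?_, ?_⟩, ⟨?_, ?_⟩, ?_⟩
  · exact ne_of_letter_ne 0 (by simp [ha, letter_one])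
  · exact ne_of_letter_ne 0 (by simp [a0, letter_one])
  · exact ne_of_letter_ne 1 (by simp [h1, letter_one])
  · exact ne_of_letter_ne 2 (by simp [b2, letter_one])
  · exact ne_of_letter_ne 0 (by simp [ha, a0])
  · exact ne_of_letter_ne 2 (by simp [ha, h2])
  · exact ne_of_letter_ne 2 (by simp [ha, b2])
  · exact ne_of_letter_ne 2 (by simp [a2, h2])
  · exact ne_of_letter_ne 3 (by simp [a3, b3])
  · exact ne_of_letter_ne 2 (by simp [h2, b2])

theorem degree_graph (hn : 4 ≤ n) (g : alternatingGroup (Fin n))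
    [Fintype ((graph n).neighborSet g)] : (graph n).degree g = 4 := by
  let : Fintype ((SimpleGraph.mulCayley (generators n)).neighborSet g) :=
    inferInstanceAs (Fintype ((graph n).neighborSet g))
  refine SimpleGraph.degree_mulCayley (S := generators n)
    (a := ⟨threeCycle n, threeCycle_mem (by omega)⟩)
    (b := ⟨longCycle n, longCycle_mem (by omega)⟩) ?_ ?_ g
  · rintro ⟨s, hs⟩
    simp [generators, permSet, Subtype.ext_iff]
  · refine List.Nodup.of_map Subtype.val ?_
    exact nodup_threeCycle_longCycle hn

end AlternatingCayley

theorem mainTheorem3 (n : ℕ) (hn : 4 ≤ n) :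
    (AlternatingCayley.graph n).IsTypeI ∧
      (AlternatingCayley.graph n).totalChromaticNumber = 5 := by
  classical
  have h := SimpleGraph.isTypeI_and_totalChromaticNumber_eq
    (fun g => AlternatingCayley.degree_graph hn g) (AlternatingCayley.totalColorable_graph_five hn)
  refine ⟨h.1, h.2.trans ?_⟩
  norm_num
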